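/- Let $S_\infty$ be the group of permutations of $\{1,2,3,\dots\}$ that fix all but finitely many elements, let $t_{i,j}$ be the transposition of $i$ and $j$, let $s_i=t_{i,i+1}$ $(i\ge 1)$, let $\ell(w)$ be the least number of factors in an expression of $w$ as a product of the $s_i$, and let $<$ be (strong) Bruhat order on $S_\infty$, i.e. the transitive closure of the relations $wt_{i,j}\lessdot w$ with $\ell(wt_{i,j})=\ell(w)-1$. Let $\mathfrak S_w\in\mathbb Z[x_1,x_2,\dots]$ $(w\in S_\infty)$ be the Schubert polynomials, determined by $\mathfrak S_{w_0}=x_1^{n-1}x_2^{n-2}\cdots x_n^0$ for the long element $w_0=n(n-1)\cdots 1$ of each $S_n\subset S_\infty$, and $\mathfrak S_{ws_i}=\dfrac{\mathfrak S_w-s_i\cdot\mathfrak S_w}{x_i-x_{i+1}}$ whenever $ws_i<w$, where $s_i$ acts on polynomials by swapping $x_i$ and $x_{i+1}$. They form a $\mathbb Z$-basis of $\mathbb Z[x_1,x_2,\dots]$; let $c_{u,v}^w\in\mathbb Z$ be the Schubert structure coefficients, defined by $\mathfrak S_u\cdot\mathfrak S_v=\sum_{w\in S_\infty}c_{u,v}^w\,\mathfrak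 S_w$. For $w\in S_\infty$ let $1\times w\in S_\infty$ be given by $(1\times w)(1)=1$ and $(1\times w)(i)=w(i-1)+1$ for $i>1$. **Proposition.** Let $u,v,w\in S_\infty$. Then $$\sum_{i\,:\,s_iu<u}c_{s_iu,v}^w+\sum_{j\,:\,s_jv<v}c_{u,s_jv}^w=c_{1\times u,1\times v}^{s_1(1\times w)}+\sum_{k\,:\,s_kw>w}c_{u,v}^{s_kw},$$ where the two sums on the left are finite and the sum on the right has only finitely many nonzero terms. -/

import Mathlib

/-- The infinite symmetric group: the permutations of `{1, 2, 3, …}` that fix all but finitely many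
elements. Everything is indexed from `0`: the natural number `m` plays the role of the letter
`m + 1`, so that `simpleTransposition m` below is the transposition usually called `s_{m+1}` and
`X m` is the variable usually called `x_{m+1}`. -/
def SInfty : Subgroup (Equiv.Perm ℕ) where
  carrier := {σ | {m | σ m ≠ m}.Finite}
  one_mem' := by simp
  mul_mem' := by
    intro σ τ hσ hτ
    refine (Set.Finite.union hσ hτ).subset ?_
    intro m hm
    by_cases h : τ m = m
    · left
      simpa [h] using hm
    · right
      exact h
  inv_mem' := by
    intro σ hσ
    refine Set.Finite.subset hσ ?_
    intro m hm h
    exact hm (Equiv.Perm.inv_eq_iff_eq.mpr h.symm)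

/-- The involution that swaps the letters `i` and `j`. -/
def transposition (i j : ℕ) : SInfty :=
  ⟨Equiv.swap i j, by
    refine Set.Finite.subset (Set.toFinite {i, j}) ?_
    intro m hm
    by_contra h
    simp only [Set.mem_insert_iff, Set.mem_singleton_iff, not_or] at h
    exact hm (Equiv.swap_apply_of_ne_of_ne h.1 h.2)⟩

/-- The simple transposition that swaps the letters `i` and `i + 1`. -/
def simpleTransposition (i : ℕ) : SInfty := transposition i (i + 1)

/-- Coxeter length: the least number of factors in an expression of `w` as a product of simple
transpositions. -/
noncomputable def coxeterLength (w : SInfty) : ℕ :=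
  sInf {k | ∃ a : List ℕ, a.length = k ∧ (a.map simpleTransposition).prod = w}

/-- The covering relation `u ⋖ w` of Bruhat order: `u = w t_{i,j}` and `ℓ(u) = ℓ(w) - 1`. -/
def BruhatCover (u w : SInfty) : Prop :=
  ∃ i j : ℕ, u = w * transposition i j ∧ coxeterLength u + 1 = coxeterLength w

/-- Strict Bruhat order `u < w`. -/
def BruhatLT (u w : SInfty) : Prop := Relation.TransGen BruhatCover u w

/-- The long element `n (n-1) ⋯ 1` of the symmetric group on the first `n` letters. -/
def longElement (n : ℕ) : SInfty :=
  ⟨Function.Involutive.toPerm (fun m => if m < n then n - 1 - m else m) (by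
      intro m
      dsimp only
      split_ifs <;> omega), by
    refine Set.Finite.subset (Set.finite_lt_nat n) ?_
    intro m hm
    by_contra h
    exact hm (if_neg h)⟩

/-- The permutation `1 × w`, which fixes the first letter and sends the successor of `m` to the
successor of `w(m)`. -/
def oneTimes (w : SInfty) : SInfty :=
  ⟨{ toFun := fun m => Nat.casesOn m 0 (fun k => w.1 k + 1)
     invFun := fun m => Nat.casesOn m 0 (fun k => w.1.symm k + 1)
     left_inv := by rintro (_ | k) <;> simp
     right_inv := by rintro (_ | k) <;> simp }, by
    have hw : {m | w.1 m ≠ m}.Finite := w.2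
    refine Set.Finite.subset (hw.image Nat.succ) ?_
    rintro (_ | k) hk
    · exact absurd rfl hk
    · refine ⟨k, ?_, rfl⟩
      intro h
      exact hk (congrArg Nat.succ h)⟩

/-- The action of `s_i` on polynomials, swapping the variables `X i` and `X (i + 1)`. -/
noncomputable def swapVars (i : ℕ) (f : MvPolynomial ℕ ℤ) : MvPolynomial ℕ ℤ :=
  MvPolynomial.rename (Equiv.swap i (i + 1)) f

theorem sub_dvd_sub_swapVars (i : ℕ) (f : MvPolynomial ℕ ℤ) :
    (MvPolynomial.X i - MvPolynomial.X (i + 1) : MvPolynomial ℕ ℤ) ∣ f - swapVars i f := by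
  induction f using MvPolynomial.induction_on with
  | C a => simp [swapVars]
  | add p q hp hq =>
    have h : p + q - swapVars i (p + q) = (p - swapVars i p) + (q - swapVars i q) := by
      simp only [swapVars, map_add]
      ring
    rw [h]
    exact dvd_add hp hq
  | mul_X p j hp =>
    have h : p * MvPolynomial.X j - swapVars i (p * MvPolynomial.X j)
        = (p - swapVars i p) * MvPolynomial.X j
          + swapVars i p * (MvPolynomial.X j - MvPolynomial.X (Equiv.swap i (i + 1) j)) := by
      simp only [swapVars, map_mul, MvPolynomial.rename_X]
      ring
    rw [h]
    refine dvd_add (Dvd.dvd.mul_right hp _) (Dvd.dvd.mul_left ?_ _)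
    by_cases h1 : j = i
    · subst h1
      simp
    · by_cases h2 : j = i + 1
      · subst h2
        rw [Equiv.swap_apply_right]
        exact ⟨-1, by ring⟩
      · rw [Equiv.swap_apply_of_ne_of_ne h1 h2, sub_self]
        exact dvd_zero _

/-- The divided difference `N_i f = (f - s_i f) / (X i - X (i + 1))`. -/
noncomputable def dividedDifference (i : ℕ) (f : MvPolynomial ℕ ℤ) : MvPolynomial ℕ ℤ :=
  (sub_dvd_sub_swapVars i f).choose

theorem dividedDifference_spec (i : ℕ) (f : MvPolynomial ℕ ℤ) :
    (MvPolynomial.X i - MvPolynomial.X (i + 1)) * dividedDifference i f = f - swapVars i f :=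
  (sub_dvd_sub_swapVars i f).choose_spec.symm

/-- `IsSchubert w f`: the recursion for Schubert polynomials assigns the polynomial `f` to `w`. It
starts from `x_1^{n-1} x_2^{n-2} ⋯ x_n^0` at the long element of each `S_n` and passes from `w` to
`w s_i` by the divided difference `N_i` whenever `w s_i < w`. -/
inductive IsSchubert : SInfty → MvPolynomial ℕ ℤ → Prop
  | long (n : ℕ) :
      IsSchubert (longElement n) (∏ m ∈ Finset.range n, MvPolynomial.X m ^ (n - 1 - m))
  | step (w : SInfty) (f : MvPolynomial ℕ ℤ) (i : ℕ) :
      IsSchubert w f → BruhatLT (w * simpleTransposition i) w →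
        IsSchubert (w * simpleTransposition i) (dividedDifference i f)

/-- The Schubert polynomial of `w`: the polynomial (it exists and is unique) that the recursion
assigns to `w`. -/
noncomputable def schubertPoly (w : SInfty) : MvPolynomial ℕ ℤ :=
  Classical.epsilon (IsSchubert w)

/-- The coefficients of the product of two Schubert polynomials in the basis of Schubert
polynomials of the free `ℤ`-module `ℤ[x_1, x_2, …]`. -/
noncomputable def schubertExpansion (u v : SInfty) : SInfty →₀ ℤ :=
  Classical.epsilon fun a : SInfty →₀ ℤ =>
    Finsupp.linearCombination ℤ schubertPoly a = schubertPoly u * schubertPoly v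

/-- The Schubert structure coefficient `c_{u,v}^w`. -/
noncomputable def schubertCoeff (u v w : SInfty) : ℤ := schubertExpansion u v w

/-! Write ∂_w for `divDiffPerm w`. The coefficient of 𝔖_w in a polynomial f is the constant term of
∂_w f (`schubertFunctional`), and these functionals separate polynomials, so identities can be
checked coefficient by coefficient.

Let ρf = f(0, x_1, x_2, …) (`shiftDown`) and Df = (∂f/∂x_1)(0, x_1, x_2, …) (`firstOrder`), so that
D(fg) = Df·ρg + ρf·Dg. Both ρ and ∂/∂x_1 are compatible with ∂_{1×w}, so the coefficient of 𝔖_w in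
Df is the x_1-coefficient of ∂_{1×w} f. The constant term of ∂_k g is the x_k-coefficient of g minus
its x_{k+1}-coefficient. Hence that x_1-coefficient is the constant term of ∂_{s_1(1×w)} f plus the
x_2-coefficient of ∂_{1×w} f. The latter is the x_1-coefficient of ∂_w ρf, which telescopes into the
constant terms of all ∂_k ∂_w ρf; only the k with s_k w > w survive. This is
`schubertFunctional_firstOrder`.

Duality yields ρ𝔖_{1×u} = 𝔖_u and, through the same identity, D𝔖_{1×u} = Σ 𝔖_{s_i u} over s_i u < u.
For f = 𝔖_{1×u} 𝔖_{1×v} the product rule then produces the left side of the theorem and the identity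
produces the right side. -/

/-! ### Simple transpositions, inversions, length and Bruhat order -/

theorem simpleTransposition_mul_self (i : ℕ) :
    simpleTransposition i * simpleTransposition i = 1 :=
  Subtype.ext (Equiv.swap_mul_self _ _)

theorem simpleTransposition_inv (i : ℕ) :
    (simpleTransposition i)⁻¹ = simpleTransposition i :=
  inv_eq_of_mul_eq_one_left (simpleTransposition_mul_self i)

theorem mul_simpleTransposition_cancel (w : SInfty) (i : ℕ) :
    w * simpleTransposition i * simpleTransposition i = w := by
  rw [mul_assoc, simpleTransposition_mul_self, mul_one]

theorem simpleTransposition_mul_cancel (w : SInfty) (i : ℕ) :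
    simpleTransposition i * (simpleTransposition i * w) = w := by
  rw [← mul_assoc, simpleTransposition_mul_self, one_mul]

theorem mul_simpleTransposition_left (w : SInfty) (i : ℕ) :
    (w * simpleTransposition i).1 i = w.1 (i + 1) := by
  change w.1 (Equiv.swap i (i + 1) i) = _
  rw [Equiv.swap_apply_left]

theorem mul_simpleTransposition_right (w : SInfty) (i : ℕ) :
    (w * simpleTransposition i).1 (i + 1) = w.1 i := by
  change w.1 (Equiv.swap i (i + 1) (i + 1)) = _
  rw [Equiv.swap_apply_right]

theorem mul_simpleTransposition_of_ne (w : SInfty) {i m : ℕ} (h1 : m ≠ i) (h2 : m ≠ i + 1) :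
    (w * simpleTransposition i).1 m = w.1 m := by
  change w.1 (Equiv.swap i (i + 1) m) = _
  rw [Equiv.swap_apply_of_ne_of_ne h1 h2]

/-- `w` lies in the symmetric group on the first `n` letters. -/
def FixesFrom (n : ℕ) (w : SInfty) : Prop := ∀ m, n ≤ m → w.1 m = m

theorem FixesFrom.mono {n k : ℕ} {w : SInfty} (h : FixesFrom n w) (hk : n ≤ k) :
    FixesFrom k w := fun m hm => h m (hk.trans hm)

theorem FixesFrom.lt {n : ℕ} {w : SInfty} (h : FixesFrom n w) {m : ℕ} (hm : m < n) :
    w.1 m < n := by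
  by_contra hc
  have h1 := h _ (not_lt.1 hc)
  have h2 := w.1.injective h1
  omega

theorem FixesFrom.mul_simpleTransposition {n : ℕ} {w : SInfty} (h : FixesFrom n w) {i : ℕ}
    (hi : i + 1 < n) : FixesFrom n (w * simpleTransposition i) := by
  intro m hm
  rw [mul_simpleTransposition_of_ne w (by omega) (by omega), h m hm]

theorem exists_fixesFrom (w : SInfty) : ∃ n, FixesFrom n w := by
  obtain ⟨b, hb⟩ := (show {m | w.1 m ≠ m}.Finite from w.2).bddAbove
  refine ⟨b + 1, fun m hm => ?_⟩
  by_contra hc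
  have : m ≤ b := hb hc
  omega

/-- The inversion set of `w`. -/
def inversions (w : SInfty) : Set (ℕ × ℕ) := {p | p.1 < p.2 ∧ w.1 p.2 < w.1 p.1}

theorem FixesFrom.snd_lt {n : ℕ} {w : SInfty} (h : FixesFrom n w) {p : ℕ × ℕ}
    (hp : p ∈ inversions w) : p.2 < n := by
  obtain ⟨h1, h2⟩ := hp
  by_contra hc
  have h3 := h p.2 (not_lt.1 hc)
  by_cases h4 : n ≤ p.1
  · have := h _ h4
    omega
  · have := h.lt (not_le.1 h4)
    omega

theorem inversions_finite (w : SInfty) : (inversions w).Finite := by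
  obtain ⟨n, hn⟩ := exists_fixesFrom w
  refine ((Set.finite_Iio n).prod (Set.finite_Iio n)).subset fun p hp => ?_
  have h1 := hn.snd_lt hp
  have h2 := hp.1
  exact ⟨h2.trans h1, h1⟩

/-- The number of inversions of `w`. -/
noncomputable def inversionNumber (w : SInfty) : ℕ := (inversions w).ncard

/-- An adjacent swap reverses a single pair. This drives both the inversion count and
`ascent_exchange`. -/
theorem swap_lt_swap_of_ne {i a b : ℕ} (h : a < b) (hne : ¬ (a = i ∧ b = i + 1)) :
    Equiv.swap i (i + 1) a < Equiv.swap i (i + 1) b := by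
  simp only [Equiv.swap_apply_def]
  split_ifs <;> omega

theorem inversions_mul_simpleTransposition {w : SInfty} {i : ℕ} (h : w.1 i < w.1 (i + 1)) :
    inversions (w * simpleTransposition i) =
      insert (i, i + 1)
        (Prod.map (Equiv.swap i (i + 1)) (Equiv.swap i (i + 1)) '' inversions w) := by
  ext ⟨a, b⟩
  have hs : ∀ m, (w * simpleTransposition i).1 m = w.1 (Equiv.swap i (i + 1) m) := fun _ => rfl
  simp only [inversions, Set.mem_ofPred_eq, Set.mem_insert_iff, Set.mem_image, Prod.exists,
    Prod.map_apply, Prod.mk.injEq, hs]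
  constructor
  · rintro ⟨h1, h2⟩
    by_cases hne : a = i ∧ b = i + 1
    · exact Or.inl hne
    · exact Or.inr ⟨_, _, ⟨swap_lt_swap_of_ne h1 hne, h2⟩, by simp, by simp⟩
  · rintro (⟨rfl, rfl⟩ | ⟨c, d, ⟨h1, h2⟩, rfl, rfl⟩)
    · simpa using h
    · refine ⟨swap_lt_swap_of_ne h1 ?_, by simpa using h2⟩
      rintro ⟨rfl, rfl⟩
      omega

theorem inversionNumber_mul_of_lt {w : SInfty} {i : ℕ} (h : w.1 i < w.1 (i + 1)) :
    inversionNumber (w * simpleTransposition i) = inversionNumber w + 1 := by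
  have hinj : Function.Injective (Prod.map (Equiv.swap i (i + 1)) (Equiv.swap i (i + 1))) :=
    (Equiv.injective _).prodMap (Equiv.injective _)
  rw [inversionNumber, inversions_mul_simpleTransposition h, Set.ncard_insert_of_notMem _
    ((inversions_finite w).image _), Set.ncard_image_of_injective _ hinj, inversionNumber]
  · rintro ⟨⟨c, d⟩, ⟨h1, h2⟩, h3⟩
    simp only [Prod.map_apply, Prod.mk.injEq] at h3
    have hc : c = i + 1 := by
      have h4 := Equiv.swap_apply_self i (i + 1) c
      rw [h3.1, Equiv.swap_apply_left] at h4
      exact h4.symm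
    have hd : d = i := by
      have h4 := Equiv.swap_apply_self i (i + 1) d
      rw [h3.2, Equiv.swap_apply_right] at h4
      exact h4.symm
    simp only at h1
    omega

theorem inversionNumber_mul_of_gt {w : SInfty} {i : ℕ} (h : w.1 (i + 1) < w.1 i) :
    inversionNumber (w * simpleTransposition i) + 1 = inversionNumber w := by
  rw [← inversionNumber_mul_of_lt, mul_simpleTransposition_cancel]
  rwa [mul_simpleTransposition_left, mul_simpleTransposition_right]

theorem lt_or_gt_succ (w : SInfty) (i : ℕ) : w.1 i < w.1 (i + 1) ∨ w.1 (i + 1) < w.1 i :=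
  lt_or_gt_of_ne fun h => by simpa using w.1.injective h

/-- For an increasing `w`, an excess `w m - m = d` never shrinks to the right of `m`, yet it is zero
far out. -/
theorem eq_one_of_forall_lt {w : SInfty} (h : ∀ i, w.1 i < w.1 (i + 1)) : w = 1 := by
  obtain ⟨n, hn⟩ := exists_fixesFrom w
  have hm : StrictMono w.1 := strictMono_nat_of_lt_succ h
  refine Subtype.ext (Equiv.ext fun m => ?_)
  change w.1 m = m
  have key : ∀ d m, w.1 m = m + d → ∀ k, m ≤ k → k + d ≤ w.1 k := by
    intro d m h0 k hk
    induction k, hk using Nat.le_induction with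
    | base => exact h0.ge
    | succ k _ ih => have := h k; omega
  have h1 := hm.le_apply (x := m)
  obtain ⟨d, hd⟩ := Nat.exists_eq_add_of_le h1
  have h2 := key d m hd (max m n) (le_max_left _ _)
  rw [hn _ (le_max_right _ _)] at h2
  omega

theorem exists_descent {w : SInfty} (h : w ≠ 1) : ∃ i, w.1 (i + 1) < w.1 i := by
  by_contra hc
  push Not at hc
  exact h (eq_one_of_forall_lt fun i => (lt_or_gt_succ w i).resolve_right (not_lt.2 (hc i)))

theorem inversionNumber_one : inversionNumber 1 = 0 := by
  rw [inversionNumber, Set.ncard_eq_zero (inversions_finite 1)]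
  refine Set.eq_empty_of_forall_notMem ?_
  rintro ⟨a, b⟩ ⟨h1, h2⟩
  exact lt_asymm h1 h2

/-- Induction along reduced words, multiplying on the right. -/
theorem SInfty.induction_ascent {P : SInfty → Prop} (one : P 1)
    (step : ∀ (w : SInfty) (i : ℕ), w.1 i < w.1 (i + 1) → P w → P (w * simpleTransposition i))
    (w : SInfty) : P w := by
  induction hn : inversionNumber w using Nat.strong_induction_on generalizing w with
  | _ n ih =>
    by_cases h : w = 1
    · exact h ▸ one
    · obtain ⟨i, hi⟩ := exists_descent h
      have h1 := inversionNumber_mul_of_gt hi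
      rw [← mul_simpleTransposition_cancel w i]
      refine step _ i ?_ (ih _ (by omega) _ rfl)
      rwa [mul_simpleTransposition_left, mul_simpleTransposition_right]

theorem exists_word (w : SInfty) :
    ∃ a : List ℕ, a.length = inversionNumber w ∧ (a.map simpleTransposition).prod = w := by
  induction w using SInfty.induction_ascent with
  | one => exact ⟨[], by simp [inversionNumber_one], rfl⟩
  | step w i h ih =>
    obtain ⟨a, h1, h2⟩ := ih
    exact ⟨a ++ [i], by simp [h1, inversionNumber_mul_of_lt h], by simp [h2]⟩

theorem inversionNumber_prod_le (a : List ℕ) :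
    inversionNumber (a.map simpleTransposition).prod ≤ a.length := by
  induction a using List.reverseRecOn with
  | nil => simp [inversionNumber_one]
  | append_singleton a i ih =>
    simp only [List.map_append, List.map_cons, List.map_nil, List.prod_append, List.prod_cons,
      List.prod_nil, mul_one, List.length_append, List.length_cons, List.length_nil]
    rcases lt_or_gt_succ (a.map simpleTransposition).prod i with h | h
    · rw [inversionNumber_mul_of_lt h]
      omega
    · have := inversionNumber_mul_of_gt h
      omega

theorem coxeterLength_eq_inversionNumber (w : SInfty) :
    coxeterLength w = inversionNumber w := by
  refine le_antisymm (Nat.sInf_le (exists_word w)) ?_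
  refine le_csInf ⟨_, exists_word w⟩ ?_
  rintro k ⟨a, rfl, rfl⟩
  exact inversionNumber_prod_le a

/-- Reversing a word inverts its product. This carries facts on right multiplication over to left
multiplication. -/
theorem inversionNumber_inv (w : SInfty) : inversionNumber w⁻¹ = inversionNumber w := by
  have key : ∀ v : SInfty, inversionNumber v⁻¹ ≤ inversionNumber v := by
    intro v
    obtain ⟨a, h1, h2⟩ := exists_word v
    have h3 : (a.reverse.map simpleTransposition).prod = v⁻¹ := by
      rw [← h2, List.prod_inv_reverse, List.map_map, List.map_reverse]
      congr 3
    rw [← h1, ← h3, ← List.length_reverse]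
    exact inversionNumber_prod_le _
  exact le_antisymm (key w) (by simpa using key w⁻¹)

theorem BruhatLT.inversionNumber_lt {u w : SInfty} (h : BruhatLT u w) :
    inversionNumber u < inversionNumber w := by
  induction h with
  | single h =>
    obtain ⟨i, j, -, h⟩ := h
    rw [coxeterLength_eq_inversionNumber, coxeterLength_eq_inversionNumber] at h
    omega
  | tail _ h ih =>
    obtain ⟨i, j, -, h⟩ := h
    rw [coxeterLength_eq_inversionNumber, coxeterLength_eq_inversionNumber] at h
    omega

theorem bruhatLT_mul_simpleTransposition_iff {w : SInfty} {i : ℕ} :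
    BruhatLT (w * simpleTransposition i) w ↔ w.1 (i + 1) < w.1 i := by
  constructor
  · intro h
    refine (lt_or_gt_succ w i).resolve_left fun h1 => ?_
    have := h.inversionNumber_lt
    rw [inversionNumber_mul_of_lt h1] at this
    omega
  · intro h
    refine Relation.TransGen.single ⟨i, i + 1, rfl, ?_⟩
    rw [coxeterLength_eq_inversionNumber, coxeterLength_eq_inversionNumber]
    exact inversionNumber_mul_of_gt h

theorem simpleTransposition_mul_inv (w : SInfty) (i : ℕ) :
    (simpleTransposition i * w)⁻¹ = w⁻¹ * simpleTransposition i := by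
  rw [mul_inv_rev, simpleTransposition_inv]

/-- Bruhat covers are defined by right multiplication; swapping two values amounts to swapping their
positions. -/
theorem simpleTransposition_mul_eq (w : SInfty) (i : ℕ) :
    simpleTransposition i * w = w * transposition (w⁻¹.1 i) (w⁻¹.1 (i + 1)) := by
  refine Subtype.ext ?_
  change Equiv.swap i (i + 1) * w.1 = w.1 * Equiv.swap (w.1.symm i) (w.1.symm (i + 1))
  rw [Equiv.mul_swap_eq_swap_mul, Equiv.apply_symm_apply, Equiv.apply_symm_apply]

theorem bruhatLT_simpleTransposition_mul_iff {w : SInfty} {i : ℕ} :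
    BruhatLT (simpleTransposition i * w) w ↔ w⁻¹.1 (i + 1) < w⁻¹.1 i := by
  have hi : inversionNumber (w⁻¹ * simpleTransposition i)
      = inversionNumber (simpleTransposition i * w) := by
    rw [← simpleTransposition_mul_inv, inversionNumber_inv]
  constructor
  · intro h
    refine (lt_or_gt_succ w⁻¹ i).resolve_left fun h1 => ?_
    have := h.inversionNumber_lt
    rw [← hi, inversionNumber_mul_of_lt h1, inversionNumber_inv] at this
    omega
  · intro h
    refine Relation.TransGen.single ⟨_, _, simpleTransposition_mul_eq w i, ?_⟩
    rw [coxeterLength_eq_inversionNumber, coxeterLength_eq_inversionNumber, ← hi,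
      inversionNumber_mul_of_gt h, inversionNumber_inv]

theorem bruhatLT_self_simpleTransposition_mul_iff {w : SInfty} {i : ℕ} :
    BruhatLT w (simpleTransposition i * w) ↔ w⁻¹.1 i < w⁻¹.1 (i + 1) := by
  have h := bruhatLT_simpleTransposition_mul_iff (w := simpleTransposition i * w) (i := i)
  rwa [simpleTransposition_mul_cancel, simpleTransposition_mul_inv, mul_simpleTransposition_left,
    mul_simpleTransposition_right] at h

theorem FixesFrom.finite_descents {n : ℕ} {w : SInfty} (h : FixesFrom n w) :
    {i : ℕ | w.1 (i + 1) < w.1 i}.Finite := by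
  refine (Set.finite_Iio n).subset fun i hi => ?_
  by_contra hc
  have hc : n ≤ i := not_lt.1 hc
  have h1 := h i hc
  have h2 := h (i + 1) (by omega)
  have hi : w.1 (i + 1) < w.1 i := hi
  omega

/-- If `w` ascends to `w s_i`, which ascends to `s_k w s_i`, then `w` ascends to `s_k w`, which
ascends to `s_k w s_i`. -/
theorem ascent_exchange {w : SInfty} {i k : ℕ} (h : w.1 i < w.1 (i + 1))
    (hk : (w * simpleTransposition i)⁻¹.1 k < (w * simpleTransposition i)⁻¹.1 (k + 1)) :
    w⁻¹.1 k < w⁻¹.1 (k + 1) ∧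
      (simpleTransposition k * w).1 i < (simpleTransposition k * w).1 (i + 1) := by
  obtain ⟨a, ha⟩ := w.1.surjective k
  obtain ⟨b, hb⟩ := w.1.surjective (k + 1)
  have ha' : w⁻¹.1 k = a := by rw [← ha]; exact w.1.symm_apply_apply a
  have hb' : w⁻¹.1 (k + 1) = b := by rw [← hb]; exact w.1.symm_apply_apply b
  have e : ∀ m, (w * simpleTransposition i)⁻¹.1 m = Equiv.swap i (i + 1) (w⁻¹.1 m) := by
    intro m
    rw [mul_inv_rev, simpleTransposition_inv]
    rfl
  rw [e, e, ha', hb'] at hk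
  rw [ha', hb']
  -- Here `a` and `b` are the positions of the values `k` and `k + 1`. The swaps of positions and of
  -- values interfere only when these are `i` and `i + 1`, which the two hypotheses exclude in
  -- either order.
  have hne : ¬ (a = i ∧ b = i + 1) := by
    rintro ⟨rfl, rfl⟩
    simp at hk
  have hne' : ¬ (a = i + 1 ∧ b = i) := by
    rintro ⟨rfl, rfl⟩
    omega
  refine ⟨?_, ?_⟩
  · by_contra hc
    have hab : a ≠ b := by
      rintro rfl
      omega
    have := swap_lt_swap_of_ne (i := i) (a := b) (b := a) (by omega) (by tauto)
    omega
  · change Equiv.swap k (k + 1) (w.1 i) < Equiv.swap k (k + 1) (w.1 (i + 1))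
    refine swap_lt_swap_of_ne h ?_
    rintro ⟨h1, h2⟩
    exact hne ⟨w.1.injective (ha.trans h1.symm), w.1.injective (hb.trans h2.symm)⟩

/-! ### Divided differences of polynomials -/

open MvPolynomial

theorem swapVars_add (i : ℕ) (f g : MvPolynomial ℕ ℤ) :
    swapVars i (f + g) = swapVars i f + swapVars i g := map_add _ f g

theorem swapVars_sub (i : ℕ) (f g : MvPolynomial ℕ ℤ) :
    swapVars i (f - g) = swapVars i f - swapVars i g := map_sub _ f g

theorem swapVars_mul (i : ℕ) (f g : MvPolynomial ℕ ℤ) :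
    swapVars i (f * g) = swapVars i f * swapVars i g := map_mul _ f g

theorem swapVars_smul (i : ℕ) (c : ℤ) (f : MvPolynomial ℕ ℤ) :
    swapVars i (c • f) = c • swapVars i f := map_smul _ c f

theorem swapVars_X_left (i : ℕ) : swapVars i (X i) = X (i + 1) := by
  rw [swapVars, rename_X, Equiv.swap_apply_left]

theorem swapVars_X_right (i : ℕ) : swapVars i (X (i + 1)) = X i := by
  rw [swapVars, rename_X, Equiv.swap_apply_right]

theorem swapVars_X_of_ne {i j : ℕ} (h1 : j ≠ i) (h2 : j ≠ i + 1) : swapVars i (X j) = X j := by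
  rw [swapVars, rename_X, Equiv.swap_apply_of_ne_of_ne h1 h2]

theorem swapVars_swapVars (i : ℕ) (f : MvPolynomial ℕ ℤ) : swapVars i (swapVars i f) = f := by
  rw [swapVars, swapVars, rename_rename]
  convert rename_id_apply f
  funext m
  simp

theorem swapVars_comm {i j : ℕ} (h : i + 1 < j) (f : MvPolynomial ℕ ℤ) :
    swapVars i (swapVars j f) = swapVars j (swapVars i f) := by
  rw [swapVars, swapVars, swapVars, swapVars, rename_rename, rename_rename]
  congr 2
  funext m
  simp only [Function.comp_apply, Equiv.swap_apply_def]
  split_ifs <;> omega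

theorem swapVars_braid (i : ℕ) (f : MvPolynomial ℕ ℤ) :
    swapVars i (swapVars (i + 1) (swapVars i f))
      = swapVars (i + 1) (swapVars i (swapVars (i + 1) f)) := by
  simp only [swapVars, rename_rename]
  congr 2
  funext m
  simp only [Function.comp_apply, Equiv.swap_apply_def]
  split_ifs <;> omega

theorem X_sub_X_ne_zero {i j : ℕ} (h : i ≠ j) : (X i - X j : MvPolynomial ℕ ℤ) ≠ 0 :=
  sub_ne_zero.2 fun h1 => h (X_injective h1)

theorem dividedDifference_eq_of_mul_eq {i : ℕ} {f g : MvPolynomial ℕ ℤ}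
    (h : (X i - X (i + 1)) * g = f - swapVars i f) : dividedDifference i f = g :=
  mul_left_cancel₀ (X_sub_X_ne_zero (Nat.succ_ne_self i).symm)
    ((dividedDifference_spec i f).trans h.symm)

/-- The divided difference as a linear operator. -/
noncomputable def divDiff (i : ℕ) : Module.End ℤ (MvPolynomial ℕ ℤ) where
  toFun := dividedDifference i
  map_add' f g := dividedDifference_eq_of_mul_eq (by
    rw [mul_add, dividedDifference_spec, dividedDifference_spec, swapVars_add]
    ring)
  map_smul' c f := dividedDifference_eq_of_mul_eq (by
    rw [RingHom.id_apply, mul_smul_comm, dividedDifference_spec, swapVars_smul, smul_sub])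

theorem divDiff_spec (i : ℕ) (f : MvPolynomial ℕ ℤ) :
    (X i - X (i + 1)) * divDiff i f = f - swapVars i f := dividedDifference_spec i f

theorem divDiff_eq_of_mul_eq {i : ℕ} {f g : MvPolynomial ℕ ℤ}
    (h : (X i - X (i + 1)) * g = f - swapVars i f) : divDiff i f = g :=
  dividedDifference_eq_of_mul_eq h

theorem divDiff_eq_zero_of_swapVars_eq {i : ℕ} {f : MvPolynomial ℕ ℤ} (h : swapVars i f = f) :
    divDiff i f = 0 :=
  divDiff_eq_of_mul_eq (by rw [h, mul_zero, sub_self])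

theorem swapVars_eq_of_divDiff_eq_zero {i : ℕ} {f : MvPolynomial ℕ ℤ} (h : divDiff i f = 0) :
    swapVars i f = f := by
  have := divDiff_spec i f
  rw [h, mul_zero] at this
  exact (sub_eq_zero.1 this.symm).symm

theorem swapVars_divDiff (i : ℕ) (f : MvPolynomial ℕ ℤ) :
    swapVars i (divDiff i f) = divDiff i f := by
  refine (divDiff_eq_of_mul_eq ?_).symm
  have h := congrArg (swapVars i) (divDiff_spec i f)
  rw [swapVars_mul, swapVars_sub, swapVars_sub, swapVars_X_left, swapVars_X_right,
    swapVars_swapVars] at h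
  linear_combination -h

theorem divDiff_mul_self (i : ℕ) : divDiff i * divDiff i = 0 :=
  LinearMap.ext fun f => divDiff_eq_zero_of_swapVars_eq (swapVars_divDiff i f)

theorem divDiff_comm {i j : ℕ} (h : i + 1 < j) : divDiff i * divDiff j = divDiff j * divDiff i := by
  refine LinearMap.ext fun f => ?_
  simp only [Module.End.mul_apply]
  refine mul_left_cancel₀ (mul_ne_zero (X_sub_X_ne_zero (i := i) (j := i + 1) (by omega))
    (X_sub_X_ne_zero (i := j) (j := j + 1) (by omega))) ?_
  have h1 := divDiff_spec i f
  have h2 := divDiff_spec j f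
  have h3 := divDiff_spec i (divDiff j f)
  have h4 := divDiff_spec j (divDiff i f)
  have h5 := congrArg (swapVars j) h1
  have h6 := congrArg (swapVars i) h2
  have h7 := swapVars_comm h f
  simp only [swapVars_mul, swapVars_sub] at h5 h6
  rw [swapVars_X_of_ne (by omega) (by omega), swapVars_X_of_ne (by omega) (by omega)] at h5 h6
  linear_combination (X j - X (j + 1)) * h3 - (X i - X (i + 1)) * h4 + h2 - h1 - h6 + h5 + h7

/-- After multiplication by the Vandermonde product of the three variables, both sides become the
alternating sum of the six images of `f` under S_3; the braid relation for swaps matches the longest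
term. -/
theorem divDiff_braid (i : ℕ) :
    divDiff i * divDiff (i + 1) * divDiff i
      = divDiff (i + 1) * divDiff i * divDiff (i + 1) := by
  refine LinearMap.ext fun f => ?_
  simp only [Module.End.mul_apply]
  have e1 : swapVars i (X (i + 1 + 1)) = X (i + 1 + 1) :=
    swapVars_X_of_ne (by omega) (by omega)
  have e2 : swapVars (i + 1) (X i) = X i := swapVars_X_of_ne (by omega) (by omega)
  refine mul_left_cancel₀ (mul_ne_zero (mul_ne_zero
    (X_sub_X_ne_zero (i := i) (j := i + 1) (by omega))
    (X_sub_X_ne_zero (i := i + 1) (j := i + 1 + 1) (by omega)))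
    (X_sub_X_ne_zero (i := i) (j := i + 1 + 1) (by omega))) ?_
  have g1 := divDiff_spec i f
  have g2 := divDiff_spec (i + 1) (divDiff i f)
  have g3 := divDiff_spec i (divDiff (i + 1) (divDiff i f))
  have g4 := congrArg (swapVars (i + 1)) g1
  have g5 := congrArg (swapVars i) g2
  have k1 := divDiff_spec (i + 1) f
  have k2 := divDiff_spec i (divDiff (i + 1) f)
  have k3 := divDiff_spec (i + 1) (divDiff i (divDiff (i + 1) f))
  have k4 := congrArg (swapVars i) k1
  have k5 := congrArg (swapVars (i + 1)) k2
  have b := swapVars_braid i f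
  simp only [swapVars_mul, swapVars_sub, swapVars_X_left, swapVars_X_right, e1, e2,
    swapVars_divDiff] at g4 g5 k4 k5
  have g6 := congrArg (swapVars i) g4
  have k6 := congrArg (swapVars (i + 1)) k4
  simp only [swapVars_mul, swapVars_sub, swapVars_X_left, swapVars_X_right, e1, e2] at g6 k6
  linear_combination (X (i + 1) - X (i + 1 + 1)) * (X i - X (i + 1 + 1)) * g3
    + (X i - X (i + 1 + 1)) * g2 - (X (i + 1) - X (i + 1 + 1)) * g5 + g1 - g4 + g6
    - (X i - X (i + 1)) * (X i - X (i + 1 + 1)) * k3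
    - (X i - X (i + 1 + 1)) * k2 + (X i - X (i + 1)) * k5 - k1 + k4 - k6 - b

/-- Degrees add over a domain. The drop in degree is the measure for the later inductions on
polynomials. -/
theorem divDiff_eq_zero_or_totalDegree_lt (i : ℕ) (f : MvPolynomial ℕ ℤ) :
    divDiff i f = 0 ∨ (divDiff i f).totalDegree < f.totalDegree := by
  refine or_iff_not_imp_left.2 fun h => ?_
  have h1 := X_sub_X_ne_zero (Nat.succ_ne_self i).symm
  have h2 := totalDegree_mul_of_isDomain h1 h
  have hh : (X i - X (i + 1) : MvPolynomial ℕ ℤ).IsHomogeneous 1 :=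
    (isHomogeneous_X ℤ i).sub (isHomogeneous_X ℤ (i + 1))
  rw [divDiff_spec, hh.totalDegree h1] at h2
  have h3 := totalDegree_sub f (swapVars i f)
  have h4 : (swapVars i f).totalDegree ≤ f.totalDegree := totalDegree_rename_le _ f
  rw [max_eq_left h4] at h3
  omega

/-- A component of degree `j` of the quotient, times the linear factor, is the component of degree
`j + 1` of the numerator, hence zero unless `j = d`. -/
theorem divDiff_isHomogeneous {d : ℕ} {f : MvPolynomial ℕ ℤ} (h : f.IsHomogeneous (d + 1))
    (i : ℕ) : (divDiff i f).IsHomogeneous d := by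
  classical
  let _ : GradedAlgebra (homogeneousSubmodule ℕ ℤ) := gradedAlgebra
  have hx : (X i - X (i + 1) : MvPolynomial ℕ ℤ) ∈ homogeneousSubmodule ℕ ℤ 1 :=
    (isHomogeneous_X ℤ i).sub (isHomogeneous_X ℤ (i + 1))
  have hf : f - swapVars i f ∈ homogeneousSubmodule ℕ ℤ (d + 1) :=
    h.sub (h.rename_isHomogeneous)
  rw [← DirectSum.sum_support_decompose (homogeneousSubmodule ℕ ℤ) (divDiff i f)]
  refine IsHomogeneous.sum _ _ _ fun j _ => ?_
  by_cases hj : j = d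
  · exact hj ▸ SetLike.coe_mem (DirectSum.decompose (homogeneousSubmodule ℕ ℤ) (divDiff i f) j)
  · have h1 := DirectSum.coe_decompose_mul_add_of_left_mem (homogeneousSubmodule ℕ ℤ) (j := j)
      (b := divDiff i f) hx
    rw [divDiff_spec, DirectSum.decompose_of_mem_ne _ hf (by omega : d + 1 ≠ 1 + j)] at h1
    rw [(mul_eq_zero.1 h1.symm).resolve_left (X_sub_X_ne_zero (Nat.succ_ne_self i).symm)]
    exact isHomogeneous_zero _ _ _

theorem mem_vars_swapVars {i j : ℕ} {f : MvPolynomial ℕ ℤ} (h : j ∈ f.vars) :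
    Equiv.swap i (i + 1) j ∈ (swapVars i f).vars := by
  rw [← swapVars_swapVars i f] at h
  obtain ⟨k, hk, rfl⟩ := mem_vars_rename _ _ h
  rwa [Equiv.swap_apply_self]

/-- Invariance under all adjacent swaps makes the finite set of variables of `f` closed under
successor, hence empty. -/
theorem eq_C_of_forall_divDiff_eq_zero {f : MvPolynomial ℕ ℤ} (h : ∀ i, divDiff i f = 0) :
    f = C (constantCoeff f) := by
  have h1 : ∀ j ∈ f.vars, j + 1 ∈ f.vars := by
    intro j hj
    have := mem_vars_swapVars (i := j) hj
    rwa [swapVars_eq_of_divDiff_eq_zero (h j), Equiv.swap_apply_left] at this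
  have h2 : f.vars = ∅ := by
    refine Finset.eq_empty_of_forall_notMem fun j hj => ?_
    have h3 : ∀ k, j + k ∈ f.vars := by
      intro k
      induction k with
      | zero => exact hj
      | succ k ih => exact h1 _ ih
    have h4 := Finset.le_sup (f := id) (h3 (f.vars.sup id + 1))
    simp only [id] at h4
    omega
  exact vars_eq_empty_iff_eq_C.1 h2

theorem exists_forall_divDiff_eq_zero (f : MvPolynomial ℕ ℤ) :
    ∃ n, ∀ i, n ≤ i → i ∉ f.vars ∧ divDiff i f = 0 := by
  have hn : ∀ i, f.vars.sup id + 1 ≤ i → i ∉ f.vars := by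
    intro i hi hf
    have := Finset.le_sup (f := id) hf
    simp only [id] at this
    omega
  refine ⟨_, fun i hi => ⟨hn i hi, divDiff_eq_zero_of_swapVars_eq ?_⟩⟩
  have h1 := hn i hi
  have h2 := hn (i + 1) (by omega)
  rw [swapVars]
  refine hom_congr_vars (f₁ := (rename (Equiv.swap i (i + 1))).toRingHom) (f₂ := RingHom.id _)
    (by ext1; simp) ?_ rfl
  intro j hj _
  have h3 : j ≠ i := fun h => h1 (h ▸ hj)
  have h4 : j ≠ i + 1 := fun h => h2 (h ▸ hj)
  simp [Equiv.swap_apply_of_ne_of_ne h3 h4]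

/-! ### Divided differences indexed by permutations -/

theorem simpleTransposition_comm {i j : ℕ} (h : i + 1 < j) :
    simpleTransposition i * simpleTransposition j
      = simpleTransposition j * simpleTransposition i := by
  refine Subtype.ext (Equiv.ext fun m => ?_)
  change Equiv.swap i (i + 1) (Equiv.swap j (j + 1) m)
    = Equiv.swap j (j + 1) (Equiv.swap i (i + 1) m)
  simp only [Equiv.swap_apply_def]
  split_ifs <;> omega

theorem simpleTransposition_braid (i : ℕ) :
    simpleTransposition i * simpleTransposition (i + 1) * simpleTransposition i
      = simpleTransposition (i + 1) * simpleTransposition i * simpleTransposition (i + 1) := by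
  refine Subtype.ext (Equiv.ext fun m => ?_)
  change Equiv.swap i (i + 1) (Equiv.swap (i + 1) (i + 1 + 1) (Equiv.swap i (i + 1) m))
    = Equiv.swap (i + 1) (i + 1 + 1) (Equiv.swap i (i + 1) (Equiv.swap (i + 1) (i + 1 + 1) m))
  simp only [Equiv.swap_apply_def]
  split_ifs <;> omega

open Classical in
/-- The composite of divided differences along a reduced word of `w`. -/
noncomputable def divDiffPerm (w : SInfty) : Module.End ℤ (MvPolynomial ℕ ℤ) :=
  if h : ∃ i, w.1 (i + 1) < w.1 i then
    divDiffPerm (w * simpleTransposition h.choose) * divDiff h.choose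
  else 1
termination_by inversionNumber w
decreasing_by
  have := inversionNumber_mul_of_gt h.choose_spec
  omega

theorem divDiffPerm_one : divDiffPerm 1 = 1 := by
  rw [divDiffPerm, dif_neg]
  rintro ⟨i, hi⟩
  have hi : i + 1 < i := hi
  omega

/-- Local confluence: two descents of `w` lead down to a common element, by the commutation relation
when they are far apart and by the braid relation when they are adjacent. -/
theorem divDiffPerm_diamond {w : SInfty} {i j : ℕ} (hij : i < j) (hi : w.1 (i + 1) < w.1 i)
    (hj : w.1 (j + 1) < w.1 j)
    (ih : ∀ v : SInfty, inversionNumber v < inversionNumber w → ∀ k, v.1 (k + 1) < v.1 k →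
      divDiffPerm v = divDiffPerm (v * simpleTransposition k) * divDiff k) :
    divDiffPerm (w * simpleTransposition i) * divDiff i
      = divDiffPerm (w * simpleTransposition j) * divDiff j := by
  have li := inversionNumber_mul_of_gt hi
  have lj := inversionNumber_mul_of_gt hj
  rcases Nat.lt_or_ge (i + 1) j with h | h
  · have hij' : (w * simpleTransposition i).1 (j + 1) < (w * simpleTransposition i).1 j := by
      rwa [mul_simpleTransposition_of_ne w (by omega) (by omega),
        mul_simpleTransposition_of_ne w (by omega) (by omega)]
    have hji' : (w * simpleTransposition j).1 (i + 1) < (w * simpleTransposition j).1 i := by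
      rwa [mul_simpleTransposition_of_ne w (by omega) (by omega),
        mul_simpleTransposition_of_ne w (by omega) (by omega)]
    rw [ih _ (by omega) j hij', ih _ (by omega) i hji', mul_assoc, mul_assoc, mul_assoc,
      mul_assoc, simpleTransposition_comm h, divDiff_comm h]
  · obtain rfl : j = i + 1 := by omega
    have h1 : (w * simpleTransposition i).1 (i + 1 + 1)
        < (w * simpleTransposition i).1 (i + 1) := by
      rw [mul_simpleTransposition_of_ne w (by omega) (by omega), mul_simpleTransposition_right]
      exact hj.trans hi
    have h2 : (w * simpleTransposition i * simpleTransposition (i + 1)).1 (i + 1)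
        < (w * simpleTransposition i * simpleTransposition (i + 1)).1 i := by
      rw [mul_simpleTransposition_left, mul_simpleTransposition_of_ne _ (by omega) (by omega),
        mul_simpleTransposition_of_ne _ (by omega) (by omega), mul_simpleTransposition_left]
      exact hj
    have h3 : (w * simpleTransposition (i + 1)).1 (i + 1)
        < (w * simpleTransposition (i + 1)).1 i := by
      rw [mul_simpleTransposition_left,
        mul_simpleTransposition_of_ne w (m := i) (by omega) (by omega)]
      exact hj.trans hi
    have h4 : (w * simpleTransposition (i + 1) * simpleTransposition i).1 (i + 1 + 1)
        < (w * simpleTransposition (i + 1) * simpleTransposition i).1 (i + 1) := by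
      rw [mul_simpleTransposition_right,
        mul_simpleTransposition_of_ne _ (m := i + 1 + 1) (by omega) (by omega),
        mul_simpleTransposition_right,
        mul_simpleTransposition_of_ne w (m := i) (by omega) (by omega)]
      exact hi
    have l1 := inversionNumber_mul_of_gt h1
    have l3 := inversionNumber_mul_of_gt h3
    rw [ih _ (by omega) _ h1, ih _ (by omega) _ h2, ih _ (by omega) _ h3, ih _ (by omega) _ h4]
    have e1 := simpleTransposition_braid i
    have e2 := divDiff_braid i
    simp only [mul_assoc] at e1 e2 ⊢
    rw [e1, e2]

/-- The recursion uses one chosen descent; confluence makes the operator independent of that choice.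
-/
theorem divDiffPerm_of_descent {w : SInfty} {j : ℕ} (hj : w.1 (j + 1) < w.1 j) :
    divDiffPerm w = divDiffPerm (w * simpleTransposition j) * divDiff j := by
  induction hn : inversionNumber w using Nat.strong_induction_on generalizing w j with
  | _ n ih =>
    subst hn
    have ih' := fun v hv k (hk : v.1 (k + 1) < v.1 k) => ih (inversionNumber v) hv hk rfl
    have h : ∃ i, w.1 (i + 1) < w.1 i := ⟨j, hj⟩
    rw [divDiffPerm, dif_pos h]
    rcases lt_trichotomy h.choose j with h1 | h1 | h1
    · exact divDiffPerm_diamond h1 h.choose_spec hj ih'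
    · rw [h1]
    · exact (divDiffPerm_diamond h1 hj h.choose_spec ih').symm

theorem divDiffPerm_mul_of_ascent {w : SInfty} {i : ℕ} (h : w.1 i < w.1 (i + 1)) :
    divDiffPerm (w * simpleTransposition i) = divDiffPerm w * divDiff i := by
  rw [divDiffPerm_of_descent (j := i), mul_simpleTransposition_cancel]
  rwa [mul_simpleTransposition_left, mul_simpleTransposition_right]

theorem divDiffPerm_mul_divDiff_of_descent {w : SInfty} {i : ℕ} (h : w.1 (i + 1) < w.1 i) :
    divDiffPerm w * divDiff i = 0 := by
  rw [divDiffPerm_of_descent h, mul_assoc, divDiff_mul_self, mul_zero]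

theorem divDiffPerm_simpleTransposition (i : ℕ) :
    divDiffPerm (simpleTransposition i) = divDiff i := by
  have h := divDiffPerm_mul_of_ascent (w := 1) (i := i) (Nat.lt_succ_self i)
  rwa [one_mul, divDiffPerm_one, one_mul] at h

/-- The definition peels letters off on the right; `ascent_exchange` keeps the words reduced when a
letter is added on the left. -/
theorem divDiffPerm_left_of_ascent {w : SInfty} {k : ℕ} (h : w⁻¹.1 k < w⁻¹.1 (k + 1)) :
    divDiffPerm (simpleTransposition k * w) = divDiff k * divDiffPerm w := by
  induction w using SInfty.induction_ascent with
  | one => rw [mul_one, divDiffPerm_one, mul_one, divDiffPerm_simpleTransposition]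
  | step w i hi ih =>
    obtain ⟨h1, h2⟩ := ascent_exchange hi h
    rw [← mul_assoc, divDiffPerm_mul_of_ascent h2, divDiffPerm_mul_of_ascent hi, ih h1, mul_assoc]

theorem divDiff_mul_divDiffPerm_of_descent {w : SInfty} {k : ℕ} (h : w⁻¹.1 (k + 1) < w⁻¹.1 k) :
    divDiff k * divDiffPerm w = 0 := by
  rw [← simpleTransposition_mul_cancel w k, divDiffPerm_left_of_ascent, ← mul_assoc,
    divDiff_mul_self, zero_mul]
  rwa [simpleTransposition_mul_inv, mul_simpleTransposition_left, mul_simpleTransposition_right]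

/-! ### Coefficient functionals -/

/-- The coefficient of the Schubert polynomial of `w` in the Schubert expansion of `f`. -/
noncomputable def schubertFunctional (w : SInfty) (f : MvPolynomial ℕ ℤ) : ℤ :=
  constantCoeff (divDiffPerm w f)

theorem schubertFunctional_add (w : SInfty) (f g : MvPolynomial ℕ ℤ) :
    schubertFunctional w (f + g) = schubertFunctional w f + schubertFunctional w g := by
  simp [schubertFunctional]

theorem schubertFunctional_sum {ι : Type*} (w : SInfty) (s : Finset ι)
    (f : ι → MvPolynomial ℕ ℤ) :
    schubertFunctional w (∑ k ∈ s, f k) = ∑ k ∈ s, schubertFunctional w (f k) := by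
  simp [schubertFunctional]

theorem schubertFunctional_smul (w : SInfty) (c : ℤ) (f : MvPolynomial ℕ ℤ) :
    schubertFunctional w (c • f) = c * schubertFunctional w f := by
  rw [schubertFunctional, map_smul, constantCoeff_smul, smul_eq_mul, schubertFunctional]

theorem schubertFunctional_sub (w : SInfty) (f g : MvPolynomial ℕ ℤ) :
    schubertFunctional w (f - g) = schubertFunctional w f - schubertFunctional w g := by
  simp [schubertFunctional]

theorem schubertFunctional_zero (w : SInfty) : schubertFunctional w 0 = 0 := by
  simp [schubertFunctional]

theorem schubertFunctional_one (f : MvPolynomial ℕ ℤ) :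
    schubertFunctional 1 f = constantCoeff f := by
  rw [schubertFunctional, divDiffPerm_one, Module.End.one_apply]

theorem schubertFunctional_divDiff_of_ascent {w : SInfty} {i : ℕ} (h : w.1 i < w.1 (i + 1))
    (f : MvPolynomial ℕ ℤ) :
    schubertFunctional w (divDiff i f) = schubertFunctional (w * simpleTransposition i) f := by
  rw [schubertFunctional, schubertFunctional, divDiffPerm_mul_of_ascent h, Module.End.mul_apply]

theorem schubertFunctional_divDiff_of_descent {w : SInfty} {i : ℕ} (h : w.1 (i + 1) < w.1 i)
    (f : MvPolynomial ℕ ℤ) : schubertFunctional w (divDiff i f) = 0 := by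
  rw [schubertFunctional, ← Module.End.mul_apply, divDiffPerm_mul_divDiff_of_descent h,
    LinearMap.zero_apply, map_zero]

/-- Each functional of `divDiff i f` is zero or a functional of `f`, so by induction on degree all
divided differences of `f` vanish. Then `f` is constant, and the functional at `1` reads off the
constant. -/
theorem eq_zero_of_forall_schubertFunctional {f : MvPolynomial ℕ ℤ}
    (h : ∀ w, schubertFunctional w f = 0) : f = 0 := by
  induction hn : f.totalDegree using Nat.strong_induction_on generalizing f with
  | _ n ih =>
    have h1 : ∀ i, divDiff i f = 0 := by
      intro i
      rcases divDiff_eq_zero_or_totalDegree_lt i f with h1 | h1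
      · exact h1
      · refine ih _ (hn ▸ h1) (fun w => ?_) rfl
        rcases lt_or_gt_succ w i with h2 | h2
        · rw [schubertFunctional_divDiff_of_ascent h2, h]
        · exact schubertFunctional_divDiff_of_descent h2 f
    have h2 := h 1
    rw [schubertFunctional_one] at h2
    rw [eq_C_of_forall_divDiff_eq_zero h1, h2, C_0]

theorem eq_of_forall_schubertFunctional {f g : MvPolynomial ℕ ℤ}
    (h : ∀ w, schubertFunctional w f = schubertFunctional w g) : f = g :=
  sub_eq_zero.1 (eq_zero_of_forall_schubertFunctional fun w => by
    rw [schubertFunctional_sub, h, sub_self])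

/-- Only finitely many `i` have `divDiff i f ≠ 0`, and each of these lowers the degree. Every `w ≠
1` in the set therefore arises from one of finitely many smaller instances. -/
theorem finite_divDiffPerm_ne_zero (f : MvPolynomial ℕ ℤ) :
    {w | divDiffPerm w f ≠ 0}.Finite := by
  induction hn : f.totalDegree using Nat.strong_induction_on generalizing f with
  | _ n ih =>
    have h1 : ∀ i, {w | divDiffPerm w (divDiff i f) ≠ 0}.Finite := by
      intro i
      rcases divDiff_eq_zero_or_totalDegree_lt i f with h1 | h1
      · simp [h1]
      · exact ih _ (hn ▸ h1) _ rfl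
    obtain ⟨m, hm⟩ := exists_forall_divDiff_eq_zero f
    refine ((Set.finite_singleton (1 : SInfty)).union ((Set.finite_Iio m).biUnion fun i _ =>
      (h1 i).image fun v => v * simpleTransposition i)).subset fun w hw => ?_
    by_cases hw1 : w = 1
    · exact Or.inl hw1
    · obtain ⟨i, hi⟩ := exists_descent hw1
      have hw : divDiffPerm w f ≠ 0 := hw
      rw [divDiffPerm_of_descent hi, Module.End.mul_apply] at hw
      refine Or.inr (Set.mem_biUnion (x := i) ?_
        ⟨_, hw, mul_simpleTransposition_cancel w i⟩)
      by_contra hc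
      rw [(hm i (not_lt.1 hc)).2, map_zero] at hw
      exact hw rfl

theorem finite_support_schubertFunctional (f : MvPolynomial ℕ ℤ) :
    (Function.support fun w => schubertFunctional w f).Finite :=
  (finite_divDiffPerm_ne_zero f).subset fun w hw h => hw (by
    change constantCoeff (divDiffPerm w f) = 0
    rw [h, map_zero])

theorem schubertFunctional_eq_zero_of_isHomogeneous {w : SInfty} {d : ℕ} {f : MvPolynomial ℕ ℤ}
    (hf : f.IsHomogeneous d) (h : inversionNumber w ≠ d) : schubertFunctional w f = 0 := by
  induction w using SInfty.induction_ascent generalizing d f with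
  | one =>
    rw [inversionNumber_one] at h
    rw [schubertFunctional_one]
    exact hf.coeff_eq_zero (by simpa using h)
  | step w i hi ih =>
    rw [inversionNumber_mul_of_lt hi] at h
    rw [← schubertFunctional_divDiff_of_ascent hi]
    cases d with
    | zero =>
      have h0 : divDiff i f = 0 := by
        refine (divDiff_eq_zero_or_totalDegree_lt i f).resolve_right fun h1 => ?_
        have := hf.totalDegree_le
        omega
      rw [h0, schubertFunctional_zero]
    | succ d => exact ih (divDiff_isHomogeneous hf i) (by omega)

/-! ### Long elements and staircase monomials -/

theorem longElement_apply (n m : ℕ) :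
    (longElement n).1 m = if m < n then n - 1 - m else m := rfl

theorem longElement_fixesFrom (n : ℕ) : FixesFrom n (longElement n) := by
  intro m hm
  rw [longElement_apply, if_neg (not_lt.2 hm)]

theorem longElement_zero : longElement 0 = 1 :=
  Subtype.ext (Equiv.ext fun _ => rfl)

theorem inversions_longElement (n : ℕ) :
    inversions (longElement n) = {p | p.1 < p.2 ∧ p.2 < n} := by
  ext p
  refine ⟨fun h => ⟨h.1, (longElement_fixesFrom n).snd_lt h⟩, fun ⟨h1, h2⟩ => ⟨h1, ?_⟩⟩
  rw [longElement_apply, longElement_apply, if_pos h2, if_pos (h1.trans h2)]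
  omega

theorem exists_ascent_of_ne_longElement {n : ℕ} {w : SInfty} (h : FixesFrom n w)
    (hw : w ≠ longElement n) : ∃ i, i + 1 < n ∧ w.1 i < w.1 (i + 1) := by
  by_contra hc
  push Not at hc
  have hd : ∀ i, i + 1 < n → w.1 (i + 1) < w.1 i := fun i hi =>
    (lt_or_gt_succ w i).resolve_left (not_lt.2 (hc i hi))
  have h1 : ∀ m, m < n → w.1 m + m + 1 ≤ n := by
    intro m
    induction m with
    | zero =>
      intro hm
      have := h.lt hm
      omega
    | succ m ih =>
      intro hm
      have := ih (by omega)
      have := hd m hm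
      omega
  -- With a descent at every position, `h1` bounds `w m` above by counting from the left end, and
  -- this bounds it below by counting from the right end.
  have h2 : ∀ k m, m + k + 1 = n → k ≤ w.1 m := by
    intro k
    induction k with
    | zero => exact fun _ _ => Nat.zero_le _
    | succ k ih =>
      intro m hm
      have := ih (m + 1) (by omega)
      have := hd m (by omega)
      omega
  refine hw (Subtype.ext (Equiv.ext fun m => ?_))
  rw [longElement_apply]
  split_ifs with hm
  · have := h1 m hm
    have := h2 (n - 1 - m) m (by omega)
    omega
  · exact h m (not_lt.1 hm)

theorem inversionNumber_lt_longElement {n : ℕ} {w : SInfty} (h : FixesFrom n w)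
    (hw : w ≠ longElement n) : inversionNumber w < inversionNumber (longElement n) := by
  obtain ⟨i, hi, hlt⟩ := exists_ascent_of_ne_longElement h hw
  refine Set.ncard_lt_ncard (Set.ssubset_iff_of_subset ?_ |>.2 ⟨(i, i + 1), ?_, ?_⟩)
    (inversions_finite _)
  · rw [inversions_longElement]
    exact fun p hp => ⟨hp.1, h.snd_lt hp⟩
  · rw [inversions_longElement]
    exact ⟨Nat.lt_succ_self i, hi⟩
  · exact fun hp => lt_asymm hp.2 hlt

theorem inversionNumber_longElement (n : ℕ) :
    inversionNumber (longElement n) = ∑ m ∈ Finset.range n, (n - 1 - m) := by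
  have h : inversions (longElement n)
      = ((Finset.range n).sigma fun b => Finset.range b).image fun p => (p.2, p.1) := by
    rw [inversions_longElement]
    ext ⟨a, b⟩
    simp [and_comm]
  rw [inversionNumber, h, Set.ncard_coe_finset, Finset.card_image_of_injOn, Finset.card_sigma]
  · simp only [Finset.card_range]
    exact (Finset.sum_range_reflect (fun j => j) n).symm
  · rintro ⟨a, b⟩ _ ⟨c, d⟩ _ h
    simp only [Prod.mk.injEq] at h
    obtain ⟨rfl, rfl⟩ := h
    rfl

/-- The staircase monomial `x_1^{n-1} x_2^{n-2} ⋯ x_n^0`. -/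
noncomputable def staircase (n : ℕ) : MvPolynomial ℕ ℤ :=
  ∏ m ∈ Finset.range n, X m ^ (n - 1 - m)

theorem staircase_isHomogeneous (n : ℕ) :
    (staircase n).IsHomogeneous (inversionNumber (longElement n)) := by
  rw [inversionNumber_longElement]
  refine IsHomogeneous.prod _ _ _ fun m _ => ?_
  simpa using (isHomogeneous_X ℤ m).pow (n - 1 - m)

/-- The permutations between the long elements of the symmetric groups on `n + 1` and on `n`
letters: the letter `n` has been moved to position `j`. -/
noncomputable def longElementStep (n : ℕ) : ℕ → SInfty
  | 0 => longElement (n + 1)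
  | j + 1 => longElementStep n j * simpleTransposition j

theorem longElementStep_apply {n j : ℕ} (h : j ≤ n) (m : ℕ) :
    (longElementStep n j).1 m
      = if m < j then n - 1 - m else if m = j then n else if m ≤ n then n - m else m := by
  induction j generalizing m with
  | zero =>
    rw [longElementStep, longElement_apply]
    split_ifs <;> omega
  | succ j ih =>
    rw [longElementStep]
    by_cases h1 : m = j
    · subst h1
      rw [mul_simpleTransposition_left, ih (by omega)]
      split_ifs <;> omega
    · by_cases h2 : m = j + 1
      · subst h2
        rw [mul_simpleTransposition_right, ih (by omega)]
        split_ifs <;> omega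
      · rw [mul_simpleTransposition_of_ne _ h1 h2, ih (by omega)]
        split_ifs <;> omega

theorem longElementStep_self (n : ℕ) : longElementStep n n = longElement n := by
  refine Subtype.ext (Equiv.ext fun m => ?_)
  rw [longElementStep_apply le_rfl, longElement_apply]
  split_ifs <;> omega

theorem longElementStep_descent {n j : ℕ} (h : j < n) :
    (longElementStep n j).1 (j + 1) < (longElementStep n j).1 j := by
  rw [longElementStep_apply h.le, longElementStep_apply h.le]
  split_ifs <;> omega

/-- The monomials between `staircase (n + 1)` and `staircase n`. -/
noncomputable def staircaseStep (n j : ℕ) : MvPolynomial ℕ ℤ :=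
  (∏ m ∈ Finset.range j, X m ^ (n - 1 - m)) * ∏ m ∈ Finset.Ico j n, X m ^ (n - m)

theorem staircaseStep_zero (n : ℕ) : staircaseStep n 0 = staircase (n + 1) := by
  rw [staircaseStep, Finset.prod_range_zero, one_mul, ← Finset.range_eq_Ico, staircase,
    Finset.prod_range_succ]
  simp

theorem staircaseStep_self (n : ℕ) : staircaseStep n n = staircase n := by
  rw [staircaseStep, Finset.Ico_self, Finset.prod_empty, mul_one, staircase]

theorem swapVars_prod_X_pow {i : ℕ} {s : Finset ℕ} (h1 : i ∉ s) (h2 : i + 1 ∉ s) (e : ℕ → ℕ) :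
    swapVars i (∏ m ∈ s, X m ^ e m) = ∏ m ∈ s, X m ^ e m := by
  rw [swapVars, map_prod]
  refine Finset.prod_congr rfl fun m hm => ?_
  rw [map_pow, rename_X, Equiv.swap_apply_of_ne_of_ne]
  · exact fun h => h1 (h ▸ hm)
  · exact fun h => h2 (h ▸ hm)

theorem divDiff_staircaseStep {n j : ℕ} (h : j < n) :
    divDiff j (staircaseStep n j) = staircaseStep n (j + 1) := by
  -- The cofactor of `X j` carries `X j` and `X (j + 1)` to the same power `n - 1 - j`, so it is
  -- symmetric in them and `divDiff j` just strips off `X j`.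
  have h1 : staircaseStep n j = X j * staircaseStep n (j + 1) := by
    rw [staircaseStep, staircaseStep, Finset.prod_range_succ, Finset.prod_eq_prod_Ico_succ_bot h]
    obtain ⟨k, rfl⟩ := Nat.exists_eq_add_of_lt h
    rw [show j + k + 1 - j = k + 1 by omega, show j + k + 1 - 1 - j = k by omega]
    ring
  have h2 : swapVars j (staircaseStep n (j + 1)) = staircaseStep n (j + 1) := by
    have h3 := swapVars_prod_X_pow (i := j) (s := Finset.range j) (by simp) (by simp)
      fun m => n - 1 - m
    rw [staircaseStep, Finset.prod_range_succ, swapVars_mul, swapVars_mul, h3]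
    rcases Nat.lt_or_ge (j + 1) n with h4 | h4
    · have h5 := swapVars_prod_X_pow (i := j) (s := Finset.Ico (j + 2) n) (by simp) (by simp)
        fun m => n - m
      rw [Finset.prod_eq_prod_Ico_succ_bot h4, swapVars_mul, h5]
      have h6 : ∀ (m k : ℕ), swapVars j (X m ^ k) = swapVars j (X m) ^ k :=
        fun m k => map_pow _ _ _
      rw [h6, h6, swapVars_X_left, swapVars_X_right, show n - (j + 1) = n - 1 - j by omega]
      ring
    · obtain rfl : n = j + 1 := by omega
      simp [swapVars]
  refine divDiff_eq_of_mul_eq ?_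
  rw [h1, swapVars_mul, h2, swapVars_X_left]
  ring

/-- On the symmetric group on `n` letters, the functionals `schubertFunctional` take on `f` the
value `c` at `w` and vanish elsewhere. -/
def IsDualBelow (n : ℕ) (c : ℤ) (w : SInfty) (f : MvPolynomial ℕ ℤ) : Prop :=
  ∀ v, FixesFrom n v → ((v = w → schubertFunctional v f = c) ∧
    (v ≠ w → schubertFunctional v f = 0))

theorem IsDualBelow.divDiff {n : ℕ} {c : ℤ} {w : SInfty} {f : MvPolynomial ℕ ℤ}
    (h : IsDualBelow n c w f) {i : ℕ} (hi : i + 1 < n) (hw : w.1 (i + 1) < w.1 i) :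
    IsDualBelow n c (w * simpleTransposition i) (divDiff i f) := by
  intro v hv
  obtain ⟨h1, h2⟩ := h _ (hv.mul_simpleTransposition hi)
  rcases lt_or_gt_succ v i with hvi | hvi
  · rw [schubertFunctional_divDiff_of_ascent hvi]
    refine ⟨?_, fun hne => h2 fun he => hne ?_⟩
    · rintro rfl
      exact h1 (mul_simpleTransposition_cancel w i)
    · rw [← he, mul_simpleTransposition_cancel]
  · rw [schubertFunctional_divDiff_of_descent hvi]
    refine ⟨?_, fun _ => rfl⟩
    rintro rfl
    rw [mul_simpleTransposition_left, mul_simpleTransposition_right] at hvi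
    exact absurd hvi (lt_asymm hw)

theorem IsDualBelow.staircase_pred {n k : ℕ} {c : ℤ} (hk : k < n)
    (h : IsDualBelow n c (longElement (k + 1)) (staircase (k + 1))) :
    IsDualBelow n c (longElement k) (staircase k) := by
  have h1 : ∀ j, j ≤ k → IsDualBelow n c (longElementStep k j) (staircaseStep k j) := by
    intro j
    induction j with
    | zero =>
      intro _
      rwa [staircaseStep_zero]
    | succ j ih =>
      intro hj
      rw [← divDiff_staircaseStep hj]
      exact (ih (by omega)).divDiff (by omega) (longElementStep_descent hj)
  rw [← longElementStep_self, ← staircaseStep_self]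
  exact h1 k le_rfl

/-- For degree reasons, within S_n only the long element can detect `staircase n`, with some value
`c`. Divided differences carry this `c` unchanged down to `staircase 0 = 1`, where it must be `1`.
-/
theorem isDualBelow_staircase {n k : ℕ} (hk : k ≤ n) :
    IsDualBelow n 1 (longElement k) (staircase k) := by
  set c := schubertFunctional (longElement n) (staircase n) with hc
  have h0 : IsDualBelow n c (longElement n) (staircase n) := by
    refine fun v hv => ⟨?_, fun hne => ?_⟩
    · rintro rfl
      rfl
    · exact schubertFunctional_eq_zero_of_isHomogeneous (staircase_isHomogeneous n)
        (inversionNumber_lt_longElement hv hne).ne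
  have h1 : ∀ k, k ≤ n → IsDualBelow n c (longElement k) (staircase k) := by
    intro k hk
    induction hk using Nat.decreasingInduction with
    | self => exact h0
    | of_succ k hk ih => exact ih.staircase_pred hk
  have h2 := (h1 0 (Nat.zero_le n) 1 fun _ _ => rfl).1 longElement_zero.symm
  rw [schubertFunctional_one, staircase, Finset.prod_range_zero, map_one] at h2
  exact h2 ▸ h1 k hk

theorem schubertFunctional_staircase (v : SInfty) (k : ℕ) :
    (v = longElement k → schubertFunctional v (staircase k) = 1) ∧
      (v ≠ longElement k → schubertFunctional v (staircase k) = 0) := by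
  obtain ⟨n, hn⟩ := exists_fixesFrom v
  exact isDualBelow_staircase (le_max_left k n) v (hn.mono (le_max_right k n))

/-! ### Schubert polynomials as the dual basis -/

open Classical in
theorem IsSchubert.schubertFunctional_eq {w : SInfty} {f : MvPolynomial ℕ ℤ}
    (h : IsSchubert w f) (v : SInfty) : schubertFunctional v f = if v = w then 1 else 0 := by
  induction h generalizing v with
  | long n =>
    obtain ⟨h1, h2⟩ := schubertFunctional_staircase v n
    split_ifs with h
    · exact h1 h
    · exact h2 h
  | step w f i _ hw ih =>
    rw [bruhatLT_mul_simpleTransposition_iff] at hw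
    change schubertFunctional v (divDiff i f) = _
    rcases lt_or_gt_succ v i with hvi | hvi
    · rw [schubertFunctional_divDiff_of_ascent hvi, ih]
      refine if_congr ⟨?_, ?_⟩ rfl rfl
      · rintro rfl
        exact (mul_simpleTransposition_cancel v i).symm
      · rintro rfl
        exact mul_simpleTransposition_cancel w i
    · rw [schubertFunctional_divDiff_of_descent hvi, if_neg]
      rintro rfl
      rw [mul_simpleTransposition_left, mul_simpleTransposition_right] at hvi
      exact absurd hvi (lt_asymm hw)

/-- Within a fixed S_n containing `w`, ascents lead up to the long element; the recursion then runs
back down. -/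
theorem exists_isSchubert (w : SInfty) : ∃ f, IsSchubert w f := by
  obtain ⟨n, hn⟩ := exists_fixesFrom w
  induction hk : inversionNumber (longElement n) - inversionNumber w using
    Nat.strong_induction_on generalizing w with
  | _ k ih =>
    by_cases hw : w = longElement n
    · exact ⟨_, hw ▸ IsSchubert.long n⟩
    · obtain ⟨i, hi, hlt⟩ := exists_ascent_of_ne_longElement hn hw
      have h1 := inversionNumber_lt_longElement hn hw
      have h2 := inversionNumber_mul_of_lt hlt
      obtain ⟨f, hf⟩ := ih _ (by omega) _ (hn.mul_simpleTransposition hi) rfl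
      have h3 := IsSchubert.step _ f i hf
      rw [bruhatLT_mul_simpleTransposition_iff, mul_simpleTransposition_left,
        mul_simpleTransposition_right, mul_simpleTransposition_cancel] at h3
      exact ⟨_, h3 hlt⟩

theorem isSchubert_schubertPoly (w : SInfty) : IsSchubert w (schubertPoly w) :=
  Classical.epsilon_spec (exists_isSchubert w)

open Classical in
theorem schubertFunctional_schubertPoly (v w : SInfty) :
    schubertFunctional v (schubertPoly w) = if v = w then 1 else 0 :=
  (isSchubert_schubertPoly w).schubertFunctional_eq v

theorem schubertFunctional_linearCombination (a : SInfty →₀ ℤ) (w : SInfty) :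
    schubertFunctional w (Finsupp.linearCombination ℤ schubertPoly a) = a w := by
  classical
  rw [Finsupp.linearCombination_apply, Finsupp.sum, schubertFunctional_sum]
  simp only [schubertFunctional_smul, schubertFunctional_schubertPoly, mul_ite, mul_one, mul_zero]
  rw [Finset.sum_ite_eq]
  split_ifs with h
  · rfl
  · exact (Finsupp.notMem_support_iff.1 h).symm

theorem exists_linearCombination_schubertPoly_eq (f : MvPolynomial ℕ ℤ) :
    ∃ a : SInfty →₀ ℤ, Finsupp.linearCombination ℤ schubertPoly a = f :=
  ⟨Finsupp.ofSupportFinite _ (finite_support_schubertFunctional f),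
    eq_of_forall_schubertFunctional fun w => by
      rw [schubertFunctional_linearCombination]
      rfl⟩

/-- Whichever expansion `Classical.epsilon` selects, the functional at `w` reads off its
coefficient. -/
theorem schubertCoeff_eq (u v w : SInfty) :
    schubertCoeff u v w = schubertFunctional w (schubertPoly u * schubertPoly v) := by
  rw [← Classical.epsilon_spec
    (exists_linearCombination_schubertPoly_eq (schubertPoly u * schubertPoly v)),
    schubertFunctional_linearCombination]
  rfl

/-! ### The shift 1 × w and the first variable -/

theorem oneTimes_succ (w : SInfty) (m : ℕ) : (oneTimes w).1 (m + 1) = w.1 m + 1 := rfl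

theorem oneTimes_injective : Function.Injective oneTimes := by
  intro u v h
  refine Subtype.ext (Equiv.ext fun m => ?_)
  have h1 := congrArg (fun x : SInfty => x.1 (m + 1)) h
  exact Nat.succ_injective h1

theorem oneTimes_one : oneTimes 1 = 1 := by
  refine Subtype.ext (Equiv.ext fun m => ?_)
  cases m <;> rfl

theorem oneTimes_mul (u v : SInfty) : oneTimes (u * v) = oneTimes u * oneTimes v := by
  refine Subtype.ext (Equiv.ext fun m => ?_)
  cases m <;> rfl

theorem oneTimes_inv (w : SInfty) : (oneTimes w)⁻¹ = oneTimes w⁻¹ :=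
  inv_eq_of_mul_eq_one_left (by rw [← oneTimes_mul, inv_mul_cancel, oneTimes_one])

theorem oneTimes_simpleTransposition (i : ℕ) :
    oneTimes (simpleTransposition i) = simpleTransposition (i + 1) := by
  refine Subtype.ext (Equiv.ext fun m => ?_)
  cases m with
  | zero => exact (Equiv.swap_apply_of_ne_of_ne (Nat.succ_ne_zero _).symm
      (Nat.succ_ne_zero _).symm).symm
  | succ m =>
    change Equiv.swap i (i + 1) m + 1 = Equiv.swap (i + 1) (i + 1 + 1) (m + 1)
    simp only [Equiv.swap_apply_def]
    split_ifs <;> omega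

theorem oneTimes_ne_simpleTransposition_zero_mul (u w : SInfty) :
    simpleTransposition 0 * oneTimes w ≠ oneTimes u := by
  intro h
  have h1 := congrArg (fun x : SInfty => x.1 0) h
  have h2 : (simpleTransposition 0 * oneTimes w).1 0 = 1 := Equiv.swap_apply_left 0 1
  exact one_ne_zero (h2.symm.trans h1)

theorem oneTimes_left_ascent_zero (w : SInfty) :
    (oneTimes w)⁻¹.1 0 < (oneTimes w)⁻¹.1 (0 + 1) := by
  rw [oneTimes_inv, oneTimes_succ]
  exact Nat.succ_pos _

/-- The specialization `f(x_1, x_2, …) ↦ f(0, x_1, x_2, …)`. -/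
noncomputable def shiftDown : MvPolynomial ℕ ℤ →ₐ[ℤ] MvPolynomial ℕ ℤ :=
  aeval fun m => Nat.casesOn m 0 X

theorem shiftDown_X_succ (m : ℕ) : shiftDown (X (m + 1)) = X m := aeval_X _ _

theorem shiftDown_X_zero : shiftDown (X 0) = 0 := aeval_X _ _

theorem shiftDown_swapVars (i : ℕ) (f : MvPolynomial ℕ ℤ) :
    shiftDown (swapVars (i + 1) f) = swapVars i (shiftDown f) := by
  have h : shiftDown.comp (rename (Equiv.swap (i + 1) (i + 1 + 1)))
      = (rename (Equiv.swap i (i + 1))).comp shiftDown := by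
    refine algHom_ext fun m => ?_
    simp only [AlgHom.comp_apply, rename_X]
    cases m with
    | zero =>
      rw [Equiv.swap_apply_of_ne_of_ne (by omega) (by omega), shiftDown_X_zero, map_zero]
    | succ m =>
      have e : Equiv.swap (i + 1) (i + 1 + 1) (m + 1) = Equiv.swap i (i + 1) m + 1 := by
        simp only [Equiv.swap_apply_def]
        split_ifs <;> omega
      rw [e, shiftDown_X_succ, shiftDown_X_succ, rename_X]
  exact DFunLike.congr_fun h f

theorem shiftDown_divDiff (i : ℕ) (f : MvPolynomial ℕ ℤ) :
    shiftDown (divDiff (i + 1) f) = divDiff i (shiftDown f) := by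
  refine (divDiff_eq_of_mul_eq ?_).symm
  rw [← shiftDown_swapVars, ← map_sub, ← divDiff_spec, map_mul, map_sub, shiftDown_X_succ,
    shiftDown_X_succ]

theorem shiftDown_divDiffPerm (w : SInfty) (f : MvPolynomial ℕ ℤ) :
    shiftDown (divDiffPerm (oneTimes w) f) = divDiffPerm w (shiftDown f) := by
  induction w using SInfty.induction_ascent generalizing f with
  | one => rw [oneTimes_one, divDiffPerm_one, Module.End.one_apply, Module.End.one_apply]
  | step w i hi ih =>
    have h : (oneTimes w).1 (i + 1) < (oneTimes w).1 (i + 1 + 1) := by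
      rw [oneTimes_succ, oneTimes_succ]
      omega
    rw [oneTimes_mul, oneTimes_simpleTransposition, divDiffPerm_mul_of_ascent h,
      divDiffPerm_mul_of_ascent hi, Module.End.mul_apply, Module.End.mul_apply, ih,
      shiftDown_divDiff]

/-- The operator `divDiff (i + 1)` does not touch `X 0`, so its defining identity can be
differentiated termwise. -/
theorem pderiv_zero_divDiff (i : ℕ) (f : MvPolynomial ℕ ℤ) :
    pderiv 0 (divDiff (i + 1) f) = divDiff (i + 1) (pderiv 0 f) := by
  refine (divDiff_eq_of_mul_eq ?_).symm
  have h := congrArg (pderiv 0) (divDiff_spec (i + 1) f)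
  have hs := pderiv_rename (Equiv.swap (i + 1) (i + 1 + 1)).injective 0 f
  rw [Equiv.swap_apply_of_ne_of_ne (by omega) (by omega)] at hs
  rw [pderiv_mul, map_sub, map_sub, pderiv_X_of_ne (by omega), pderiv_X_of_ne (by omega), sub_self,
    zero_mul, zero_add, swapVars, hs] at h
  exact h

theorem pderiv_zero_divDiffPerm (w : SInfty) (f : MvPolynomial ℕ ℤ) :
    pderiv 0 (divDiffPerm (oneTimes w) f) = divDiffPerm (oneTimes w) (pderiv 0 f) := by
  induction w using SInfty.induction_ascent generalizing f with
  | one => rw [oneTimes_one, divDiffPerm_one, Module.End.one_apply, Module.End.one_apply]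
  | step w i hi ih =>
    have h : (oneTimes w).1 (i + 1) < (oneTimes w).1 (i + 1 + 1) := by
      rw [oneTimes_succ, oneTimes_succ]
      omega
    rw [oneTimes_mul, oneTimes_simpleTransposition, divDiffPerm_mul_of_ascent h,
      Module.End.mul_apply, Module.End.mul_apply, ih, pderiv_zero_divDiff]

theorem constantCoeff_shiftDown (f : MvPolynomial ℕ ℤ) :
    constantCoeff (shiftDown f) = constantCoeff f := by
  have h : (constantCoeff : MvPolynomial ℕ ℤ →+* ℤ).comp shiftDown.toRingHom
      = constantCoeff := by
    refine ringHom_ext (fun r => by simp) fun m => ?_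
    cases m with
    | zero => exact (congrArg constantCoeff shiftDown_X_zero).trans (by simp)
    | succ m => exact (congrArg constantCoeff (shiftDown_X_succ m)).trans (by simp)
  exact RingHom.congr_fun h f

/-- The first-order coefficient in the first variable, `f ↦ (∂f/∂x_1)(0, x_1, x_2, …)`. -/
noncomputable def firstOrder (f : MvPolynomial ℕ ℤ) : MvPolynomial ℕ ℤ := shiftDown (pderiv 0 f)

theorem firstOrder_mul (f g : MvPolynomial ℕ ℤ) :
    firstOrder (f * g) = firstOrder f * shiftDown g + shiftDown f * firstOrder g := by
  rw [firstOrder, pderiv_mul, map_add, map_mul, map_mul, firstOrder, firstOrder]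

theorem schubertFunctional_shiftDown (w : SInfty) (f : MvPolynomial ℕ ℤ) :
    schubertFunctional w (shiftDown f) = schubertFunctional (oneTimes w) f := by
  rw [schubertFunctional, ← shiftDown_divDiffPerm, constantCoeff_shiftDown, schubertFunctional]

/-- Differentiate the defining identity in `X k` and take constant terms: the linear factor dies,
and the swap turns the derivative in `X k` into the one in `X (k + 1)`. -/
theorem constantCoeff_divDiff (k : ℕ) (f : MvPolynomial ℕ ℤ) :
    constantCoeff (divDiff k f)
      = constantCoeff (pderiv k f) - constantCoeff (pderiv (k + 1) f) := by
  have h := congrArg (fun g => constantCoeff (pderiv k g)) (divDiff_spec k f)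
  have hs := pderiv_rename (Equiv.swap k (k + 1)).injective (k + 1) f
  rw [Equiv.swap_apply_right] at hs
  simp only [pderiv_mul, map_sub, swapVars, hs, constantCoeff_rename, map_add, map_mul,
    pderiv_X_self, pderiv_X_of_ne (Nat.succ_ne_self k), constantCoeff_X] at h
  simpa using h

theorem constantCoeff_pderiv_one (f : MvPolynomial ℕ ℤ) :
    constantCoeff (pderiv 1 f) = constantCoeff (pderiv 0 (shiftDown f)) := by
  induction f using MvPolynomial.induction_on with
  | C a => simp
  | add p q hp hq => simp only [map_add, hp, hq]
  | mul_X p j hp =>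
    simp only [map_mul shiftDown, pderiv_mul, map_add, map_mul constantCoeff]
    rw [hp,
      constantCoeff_shiftDown, constantCoeff_shiftDown]
    congr 2
    rcases j with _ | _ | j
    · rw [shiftDown_X_zero, pderiv_X_of_ne (by omega), map_zero, map_zero, map_zero]
    · rw [shiftDown_X_succ, pderiv_X_self, pderiv_X_self]
    · rw [shiftDown_X_succ, pderiv_X_of_ne (by omega), pderiv_X_of_ne (by omega)]

theorem finite_support_constantCoeff_divDiff (f : MvPolynomial ℕ ℤ) :
    (Function.support fun k => constantCoeff (divDiff k f)).Finite := by
  obtain ⟨n, hn⟩ := exists_forall_divDiff_eq_zero f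
  refine (Set.finite_Iio n).subset fun k hk => ?_
  by_contra hc
  refine hk ?_
  change constantCoeff (divDiff k f) = 0
  rw [(hn k (not_lt.1 hc)).2, map_zero]

/-- The differences of consecutive linear coefficients telescope, and the last one involves a
variable absent from `f`. -/
theorem finsum_constantCoeff_divDiff (f : MvPolynomial ℕ ℤ) :
    ∑ᶠ k : ℕ, constantCoeff (divDiff k f) = constantCoeff (pderiv 0 f) := by
  obtain ⟨n, hn⟩ := exists_forall_divDiff_eq_zero f
  rw [finsum_eq_sum_of_support_subset (s := Finset.range n)]
  · simp only [constantCoeff_divDiff]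
    rw [Finset.sum_range_sub', pderiv_eq_zero_of_notMem_vars (hn n le_rfl).1, map_zero, sub_zero]
  · intro k hk
    rw [Finset.coe_range]
    by_contra hc
    refine hk ?_
    change constantCoeff (divDiff k f) = 0
    rw [(hn k (not_lt.1 hc)).2, map_zero]

theorem constantCoeff_divDiff_divDiffPerm_of_ascent {w : SInfty} {k : ℕ}
    (h : w⁻¹.1 k < w⁻¹.1 (k + 1)) (f : MvPolynomial ℕ ℤ) :
    constantCoeff (divDiff k (divDiffPerm w f))
      = schubertFunctional (simpleTransposition k * w) f := by
  rw [schubertFunctional, divDiffPerm_left_of_ascent h, Module.End.mul_apply]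

theorem constantCoeff_divDiff_divDiffPerm_of_descent {w : SInfty} {k : ℕ}
    (h : w⁻¹.1 (k + 1) < w⁻¹.1 k) (f : MvPolynomial ℕ ℤ) :
    constantCoeff (divDiff k (divDiffPerm w f)) = 0 := by
  rw [← Module.End.mul_apply, divDiff_mul_divDiffPerm_of_descent h, LinearMap.zero_apply, map_zero]

theorem finsum_schubertFunctional_left_ascents (w : SInfty) (f : MvPolynomial ℕ ℤ) :
    ∑ᶠ (k : ℕ) (_ : w⁻¹.1 k < w⁻¹.1 (k + 1)), schubertFunctional (simpleTransposition k * w) f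
      = constantCoeff (pderiv 0 (divDiffPerm w f)) := by
  rw [← finsum_constantCoeff_divDiff]
  refine finsum_congr fun k => ?_
  rcases lt_or_gt_succ w⁻¹ k with h | h
  · rw [finsum_eq_if, if_pos h, constantCoeff_divDiff_divDiffPerm_of_ascent h]
  · rw [finsum_eq_if, if_neg (lt_asymm h), constantCoeff_divDiff_divDiffPerm_of_descent h]

/-- A `finsum` over an infinite support is `0` by default; this finiteness rules that out. -/
theorem finite_schubertFunctional_left_ascents (w : SInfty) (f : MvPolynomial ℕ ℤ) :
    {k : ℕ | w⁻¹.1 k < w⁻¹.1 (k + 1) ∧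
      schubertFunctional (simpleTransposition k * w) f ≠ 0}.Finite :=
  (finite_support_constantCoeff_divDiff (divDiffPerm w f)).subset fun k ⟨h1, h2⟩ => by
    rwa [Function.mem_support, constantCoeff_divDiff_divDiffPerm_of_ascent h1]

/-- The key identity. With `g = divDiffPerm (oneTimes w) f`, the left side is the `X 0`-coefficient
of `g`. It equals the constant term of `divDiff 0 g` plus the `X 1`-coefficient of `g`, and the
latter survives `shiftDown` as an `X 0`-coefficient. -/
theorem schubertFunctional_firstOrder (w : SInfty) (f : MvPolynomial ℕ ℤ) :
    schubertFunctional w (firstOrder f)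
      = schubertFunctional (simpleTransposition 0 * oneTimes w) f
        + constantCoeff (pderiv 0 (divDiffPerm w (shiftDown f))) := by
  rw [firstOrder, schubertFunctional_shiftDown, schubertFunctional, ← pderiv_zero_divDiffPerm,
    ← shiftDown_divDiffPerm, ← constantCoeff_pderiv_one,
    ← constantCoeff_divDiff_divDiffPerm_of_ascent (oneTimes_left_ascent_zero w),
    constantCoeff_divDiff]
  ring

/-! ### First-order expansion of 𝔖_{1×u} and the final comparison -/

theorem shiftDown_schubertPoly_oneTimes (u : SInfty) :
    shiftDown (schubertPoly (oneTimes u)) = schubertPoly u := by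
  classical
  refine eq_of_forall_schubertFunctional fun w => ?_
  rw [schubertFunctional_shiftDown, schubertFunctional_schubertPoly,
    schubertFunctional_schubertPoly]
  exact if_congr oneTimes_injective.eq_iff rfl rfl

theorem finite_left_descents (w : SInfty) : {k : ℕ | w⁻¹.1 (k + 1) < w⁻¹.1 k}.Finite := by
  obtain ⟨n, hn⟩ := exists_fixesFrom w⁻¹
  exact hn.finite_descents

theorem left_ascent_and_eq_iff {u w : SInfty} {k : ℕ} :
    (w⁻¹.1 k < w⁻¹.1 (k + 1) ∧ simpleTransposition k * w = u) ↔
      (u⁻¹.1 (k + 1) < u⁻¹.1 k ∧ w = simpleTransposition k * u) := by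
  constructor
  · rintro ⟨h, rfl⟩
    rw [simpleTransposition_mul_inv, mul_simpleTransposition_left, mul_simpleTransposition_right]
    exact ⟨h, (simpleTransposition_mul_cancel w k).symm⟩
  · rintro ⟨h, rfl⟩
    rw [simpleTransposition_mul_inv, mul_simpleTransposition_left, mul_simpleTransposition_right]
    exact ⟨h, simpleTransposition_mul_cancel u k⟩

/-- In the key identity the first term vanishes, since `simpleTransposition 0 * oneTimes w` moves
the first letter and `oneTimes u` does not. The sum over left ascents retains the `k` with
`simpleTransposition k * w = u`, which are left descents of `u`. -/
theorem firstOrder_schubertPoly_oneTimes (u : SInfty) :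
    firstOrder (schubertPoly (oneTimes u))
      = ∑ k ∈ (finite_left_descents u).toFinset, schubertPoly (simpleTransposition k * u) := by
  classical
  refine eq_of_forall_schubertFunctional fun w => ?_
  rw [schubertFunctional_firstOrder, shiftDown_schubertPoly_oneTimes,
    schubertFunctional_schubertPoly, if_neg (oneTimes_ne_simpleTransposition_zero_mul u w),
    zero_add, ← finsum_schubertFunctional_left_ascents, schubertFunctional_sum,
    ← finsum_mem_finset_eq_sum]
  refine finsum_congr fun k => ?_
  rw [finsum_eq_if, finsum_eq_if]
  simp only [schubertFunctional_schubertPoly, Set.Finite.mem_toFinset, Set.mem_ofPred_eq, ← ite_and]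
  exact if_congr left_ascent_and_eq_iff rfl rfl

theorem mainTheorem5 (u v w : SInfty) :
    {i : ℕ | BruhatLT (simpleTransposition i * u) u}.Finite ∧
    {j : ℕ | BruhatLT (simpleTransposition j * v) v}.Finite ∧
    {k : ℕ | BruhatLT w (simpleTransposition k * w) ∧
      schubertCoeff u v (simpleTransposition k * w) ≠ 0}.Finite ∧
    (∑ᶠ (i : ℕ) (_ : BruhatLT (simpleTransposition i * u) u),
        schubertCoeff (simpleTransposition i * u) v w)
      + (∑ᶠ (j : ℕ) (_ : BruhatLT (simpleTransposition j * v) v),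
        schubertCoeff u (simpleTransposition j * v) w)
    = schubertCoeff (oneTimes u) (oneTimes v) (simpleTransposition 0 * oneTimes w)
      + ∑ᶠ (k : ℕ) (_ : BruhatLT w (simpleTransposition k * w)),
        schubertCoeff u v (simpleTransposition k * w) := by
  simp only [bruhatLT_simpleTransposition_mul_iff, bruhatLT_self_simpleTransposition_mul_iff,
    schubertCoeff_eq]
  refine ⟨finite_left_descents u, finite_left_descents v,
    finite_schubertFunctional_left_ascents w _, ?_⟩
  -- Apply the key identity to the product and expand its left side by the product rule.
  have h := schubertFunctional_firstOrder w
    (schubertPoly (oneTimes u) * schubertPoly (oneTimes v))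
  rw [map_mul, firstOrder_mul, shiftDown_schubertPoly_oneTimes, shiftDown_schubertPoly_oneTimes,
    firstOrder_schubertPoly_oneTimes, firstOrder_schubertPoly_oneTimes, Finset.sum_mul,
    Finset.mul_sum, schubertFunctional_add, schubertFunctional_sum, schubertFunctional_sum,
    ← finsum_schubertFunctional_left_ascents] at h
  rw [← h]
  exact congrArg₂ (· + ·)
    (finsum_mem_eq_finite_toFinset_sum _ (finite_left_descents u))
    (finsum_mem_eq_finite_toFinset_sum _ (finite_left_descents v))
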